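/- Let $N\ge 2$, let $A\in\mathbb{R}^{N\times N}$ be symmetric positive definite with distinct eigenvalues $0<\lambda_1<\dots<\lambda_N$ and an orthonormal basis of eigenvectors $v_1,\dots,v_N$, $Av_i=\lambda_iv_i$, and let $\kappa=\lambda_N/\lambda_1$. Let $b,x_0\in\mathbb{R}^N$, and let $\{x_n\}$ be generated by the minimal gradient method \[ x_{n+1}=x_n-\alpha_n g_n,\qquad g_n=Ax_n-b,\qquad \alpha_n=\frac{g_n^\intercal Ag_n}{g_n^\intercal A^2g_n}. \] Write $g_n=\sum_{i=1}^N\zeta_{i,n}v_i$ and assume $\zeta_{1,0}\neq 0$ and $\zeta_{N,0}\neq 0$. Then there is a constant $c\neq 0$ (which may depend on $A$, $b$ and $x_0$) such that all of the following hold, where $\|\cdot\|$ is the Euclidean norm. (a) For every $i\in\{1,\dots,N\}$, \[ \lim_{n\to\infty}\frac{\lambda_i\zeta_{i,2n}^2}{\sum_{j=1}^N\lambda_j\zeta_{j,2n}^2}= \begin{cases}\frac{1}{1+c^2},& i=1,\\ 0,& 1<i<N,\\ \frac{c^2}{1+c^2},& i=N,\end{cases} \qquad \lim_{n\to\infty}\frac{\lambda_i\zeta_{i,2n+1}^2}{\sum_{j=1}^N\lambda_j\zeta_{j,2n+1}^2}=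 \begin{cases}\frac{c^2}{1+c^2},& i=1,\\ 0,& 1<i<N,\\ \frac{1}{1+c^2},& i=N.\end{cases} \] (b) \[ \lim_{n\to\infty}\alpha_{2n}=\frac{1+c^2}{\lambda_1(1+c^2\kappa)},\qquad \lim_{n\to\infty}\alpha_{2n+1}=\frac{1+c^2}{\lambda_1(c^2+\kappa)}. \] (c) \[ \lim_{n\to\infty}\frac{\|g_{n+1}\|^2}{\|g_n\|^2}=\frac{c^2(\kappa-1)^2}{(c^2+\kappa)(1+c^2\kappa)}. \] (d) \[ \lim_{n\to\infty}\frac{g_{2n+1}^\intercal Ag_{2n+1}}{g_{2n}^\intercal Ag_{2n}}=\frac{c^2(\kappa-1)^2}{(1+c^2\kappa)^2},\qquad \lim_{n\to\infty}\frac{g_{2n+2}^\intercal Ag_{2n+2}}{g_{2n+1}^\intercal Ag_{2n+1}}=\frac{c^2(\kappa-1)^2}{(c^2+\kappa)^2}. \] -/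

import Mathlib

open Filter Topology

noncomputable section

namespace MinimalGradient

variable {N : ℕ}

/-- The gradient `g(x) = A x - b` of the quadratic `x ↦ xᵀ A x / 2 - bᵀ x`. -/
def grad (A : Matrix (Fin N) (Fin N) ℝ) (b x : EuclideanSpace ℝ (Fin N)) :
    EuclideanSpace ℝ (Fin N) :=
  Matrix.toEuclideanLin A x - b

/-- The quadratic form `gᵀ M g`. -/
def quad (M : Matrix (Fin N) (Fin N) ℝ) (g : EuclideanSpace ℝ (Fin N)) : ℝ :=
  inner ℝ g (Matrix.toEuclideanLin M g)

/-- The minimal gradient steplength `gᵀ A g / gᵀ A² g` at the gradient `g`. -/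
def step (A : Matrix (Fin N) (Fin N) ℝ) (g : EuclideanSpace ℝ (Fin N)) : ℝ :=
  quad A g / quad (A ^ 2) g

/-- The iterates `x_{n+1} = x_n - α_n g_n` of the minimal gradient method started at `x₀`. -/
def iter (A : Matrix (Fin N) (Fin N) ℝ) (b x₀ : EuclideanSpace ℝ (Fin N)) :
    ℕ → EuclideanSpace ℝ (Fin N)
  | 0 => x₀
  | n + 1 => iter A b x₀ n - step A (grad A b (iter A b x₀ n)) • grad A b (iter A b x₀ n)

/-- The gradient `g_n = A x_n - b` at the `n`-th iterate. -/
def gradSeq (A : Matrix (Fin N) (Fin N) ℝ) (b x₀ : EuclideanSpace ℝ (Fin N)) (n : ℕ) :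
    EuclideanSpace ℝ (Fin N) :=
  grad A b (iter A b x₀ n)

/-- The steplength `α_n` used by the method at the `n`-th iterate. -/
def stepSeq (A : Matrix (Fin N) (Fin N) ℝ) (b x₀ : EuclideanSpace ℝ (Fin N)) (n : ℕ) : ℝ :=
  step A (gradSeq A b x₀ n)

/-- The coefficient `ζ_{i,n}` in the expansion `g_n = ∑ i, ζ_{i,n} v_i`. -/
def coeff (A : Matrix (Fin N) (Fin N) ℝ) (b x₀ : EuclideanSpace ℝ (Fin N))
    (v : OrthonormalBasis (Fin N) ℝ (EuclideanSpace ℝ (Fin N))) (i : Fin N) (n : ℕ) : ℝ :=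
  v.repr (gradSeq A b x₀ n) i

/-- The normalized weight `λ_i ζ_{i,n}² / ∑ j, λ_j ζ_{j,n}²`. -/
def weight (A : Matrix (Fin N) (Fin N) ℝ) (b x₀ : EuclideanSpace ℝ (Fin N))
    (v : OrthonormalBasis (Fin N) ℝ (EuclideanSpace ℝ (Fin N))) (lam : Fin N → ℝ)
    (i : Fin N) (n : ℕ) : ℝ :=
  lam i * coeff A b x₀ v i n ^ 2 / ∑ j, lam j * coeff A b x₀ v j n ^ 2

end MinimalGradient

end

/-! Put `p i = λ_i ζ_i² / ∑ j, λ_j ζ_j²`. The steplength is the reciprocal of the mean `m` of `λ`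
under `p` (`stepSeq_eq`), so `ζ_i` is multiplied by `1 - λ_i / m`, and `p` evolves by an autonomous
rule: multiply by `(λ_i - m)²` and renormalize by the variance (`weight_succ`).

Akaike's argument treats this rule. The product of the two extreme weights never decreases, by the
Bhatia–Davis inequality; since it converges to a positive limit, the defect in that inequality
vanishes and all interior weights die (`exists_tendsto_prod`). For a vector carried by the two
extremes, the rule merely swaps the masses, so the even iterates move less and less while their
product of masses converges; this forces convergence (`exists_tendsto_twoPoint`).

Steplengths and ratios of gradient sizes are continuous functions of consecutive weight vectors near
these limits, and `c² = (1 - r) / r`, with `r` the limiting even mass at the smallest eigenvalue. -/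

namespace MinimalGradient

/-! ### Reweighting dynamics on probability vectors -/

section Weights

variable {ι : Type*} [Fintype ι]

/-- The mean of `lam` under the weights `p`. -/
def mean (lam p : ι → ℝ) : ℝ := ∑ i, p i * lam i

/-- The variance of `lam` under the weights `p`. -/
def spread (lam p : ι → ℝ) : ℝ := ∑ i, p i * (lam i - mean lam p) ^ 2

theorem continuous_mean (lam : ι → ℝ) : Continuous (mean lam) := by
  unfold mean; fun_prop

theorem continuous_spread (lam : ι → ℝ) : Continuous (spread lam) := by
  have := continuous_mean lam
  unfold spread; fun_prop

theorem mean_sub {lam p : ι → ℝ} (hp : ∑ i, p i = 1) (a : ℝ) :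
    mean lam p - a = ∑ i, p i * (lam i - a) := by
  simp only [mul_sub, Finset.sum_sub_distrib, ← Finset.sum_mul, hp, mean, one_mul]

theorem sub_mean {lam p : ι → ℝ} (hp : ∑ i, p i = 1) (a : ℝ) :
    a - mean lam p = ∑ i, p i * (a - lam i) := by
  simp only [mul_sub, Finset.sum_sub_distrib, ← Finset.sum_mul, hp, mean, one_mul]

/-- The defect in the Bhatia–Davis inequality is a sum of nonnegative terms. -/
theorem bhatia_davis {lam p : ι → ℝ} (hp : ∑ i, p i = 1) (s t : ℝ) :
    (mean lam p - s) * (t - mean lam p) - spread lam p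
      = ∑ i, p i * ((lam i - s) * (t - lam i)) := by
  have h1 : ∑ i, p i * ((lam i - s) * (t - lam i))
      = (s + t) * mean lam p - s * t * ∑ i, p i - ∑ i, p i * lam i ^ 2 := by
    simp only [mean, Finset.mul_sum, ← Finset.sum_sub_distrib]
    exact Finset.sum_congr rfl fun i _ => by ring
  have h2 : spread lam p = ∑ i, p i * lam i ^ 2 - 2 * mean lam p * ∑ i, p i * lam i
      + mean lam p ^ 2 * ∑ i, p i := by
    simp only [spread, Finset.mul_sum, ← Finset.sum_sub_distrib, ← Finset.sum_add_distrib]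
    exact Finset.sum_congr rfl fun i _ => by ring
  rw [h1, h2, hp, show ∑ i, p i * lam i = mean lam p from rfl]
  ring

/-- The two-point weights with mass `r` at `a` and `1 - r` at `b`. -/
def twoPoint [DecidableEq ι] (a b : ι) (r : ℝ) (i : ι) : ℝ :=
  if i = a then r else if i = b then 1 - r else 0

theorem sum_twoPoint [DecidableEq ι] {a b : ι} (hab : a ≠ b) (r : ℝ) (f : ι → ℝ) :
    ∑ i, twoPoint a b r i * f i = r * f a + (1 - r) * f b := by
  have h : ∀ i, twoPoint a b r i * f i
      = (if i = a then r * f a else 0) + (if i = b then (1 - r) * f b else 0) := by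
    intro i
    unfold twoPoint
    split_ifs with h1 h2 <;> simp_all
  simp [h, Finset.sum_add_distrib]

theorem mean_twoPoint [DecidableEq ι] {a b : ι} (hab : a ≠ b) (lam : ι → ℝ) (r : ℝ) :
    mean lam (twoPoint a b r) = r * lam a + (1 - r) * lam b :=
  sum_twoPoint hab r lam

theorem spread_twoPoint [DecidableEq ι] {a b : ι} (hab : a ≠ b) (lam : ι → ℝ) (r : ℝ) :
    spread lam (twoPoint a b r) = r * (1 - r) * (lam b - lam a) ^ 2 := by
  rw [spread, sum_twoPoint hab, mean_twoPoint hab]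
  ring

/-- The distance of `x n` from `1 / 2` converges to `s = √(1 / 4 - L)`. If `s > 0`, then eventually
that distance exceeds `s / 2` while the increments are below `s / 2`, so `x` cannot cross `1 / 2`
and settles at one of the two roots. -/
theorem tendsto_of_mul_one_sub {x : ℕ → ℝ} {L : ℝ}
    (h1 : Tendsto (fun n => x n * (1 - x n)) atTop (𝓝 L))
    (h2 : Tendsto (fun n => x (n + 1) - x n) atTop (𝓝 0)) :
    ∃ r, Tendsto x atTop (𝓝 r) := by
  have habs : Tendsto (fun n => |x n - 1 / 2|) atTop (𝓝 (√(1 / 4 - L))) := by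
    have : Tendsto (fun n => √(1 / 4 - x n * (1 - x n))) atTop (𝓝 (√(1 / 4 - L))) :=
      (h1.const_sub _).sqrt
    refine this.congr fun n => ?_
    rw [← Real.sqrt_sq_eq_abs]
    congr 1
    ring
  have hs0 := Real.sqrt_nonneg (1 / 4 - L)
  generalize √(1 / 4 - L) = s at habs hs0
  rcases hs0.eq_or_lt with hs | hs
  · refine ⟨1 / 2, ?_⟩
    rw [tendsto_iff_dist_tendsto_zero]
    simpa [Real.dist_eq, ← hs] using habs
  · have hs2 : s / 2 < s := half_lt_self hs
    obtain ⟨n₀, hn₀⟩ := eventually_atTop.1 ((habs.eventually (lt_mem_nhds hs2)).and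
      (h2.eventually (Metric.ball_mem_nhds 0 (half_pos hs))))
    have hstep : ∀ n ≥ n₀, s / 2 < |x n - 1 / 2| ∧ |x (n + 1) - x n| < s / 2 := by
      intro n hn
      simpa [Real.dist_eq] using hn₀ n hn
    rcases le_total (x n₀) (1 / 2) with h0 | h0
    · have hle : ∀ n ≥ n₀, x n ≤ 1 / 2 := by
        intro n hn
        induction n, hn using Nat.le_induction with
        | base => exact h0
        | succ n hn ih =>
          have := hstep n hn
          rw [abs_of_nonpos (by linarith), abs_lt] at this
          linarith
      refine ⟨1 / 2 - s, (habs.const_sub (1 / 2)).congr' ?_⟩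
      filter_upwards [eventually_ge_atTop n₀] with n hn
      rw [abs_of_nonpos (by linarith [hle n hn])]
      ring
    · have hge : ∀ n ≥ n₀, 1 / 2 ≤ x n := by
        intro n hn
        induction n, hn using Nat.le_induction with
        | base => exact h0
        | succ n hn ih =>
          have := hstep n hn
          rw [abs_of_nonneg (by linarith), abs_lt] at this
          linarith
      refine ⟨1 / 2 + s, (habs.const_add (1 / 2)).congr' ?_⟩
      filter_upwards [eventually_ge_atTop n₀] with n hn
      rw [abs_of_nonneg (by linarith [hge n hn])]
      ring

/-- `p` is a probability vector charging `a` and `b`, where `lam` is minimal at `a`, maximal at `b`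
and strictly in between elsewhere. -/
structure IsSpread (lam : ι → ℝ) (a b : ι) (p : ι → ℝ) : Prop where
  lt : lam a < lam b
  bounds : ∀ i, i ≠ a → i ≠ b → lam a < lam i ∧ lam i < lam b
  nonneg : ∀ i, 0 ≤ p i
  sum_eq : ∑ i, p i = 1
  pos_left : 0 < p a
  pos_right : 0 < p b

namespace IsSpread

variable {lam p : ι → ℝ} {a b : ι}

theorem ne (h : IsSpread lam a b p) : a ≠ b := fun e => (e ▸ h.lt).false

theorem le_lam (h : IsSpread lam a b p) (i : ι) : lam a ≤ lam i := by
  by_cases h1 : i = a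
  · rw [h1]
  by_cases h2 : i = b
  · rw [h2]; exact h.lt.le
  exact (h.bounds i h1 h2).1.le

theorem lam_le (h : IsSpread lam a b p) (i : ι) : lam i ≤ lam b := by
  by_cases h1 : i = a
  · rw [h1]; exact h.lt.le
  by_cases h2 : i = b
  · rw [h2]
  exact (h.bounds i h1 h2).2.le

theorem lt_mean (h : IsSpread lam a b p) : lam a < mean lam p := by
  rw [← sub_pos, mean_sub h.sum_eq]
  exact Finset.sum_pos' (fun i _ => mul_nonneg (h.nonneg i) (sub_nonneg.2 (h.le_lam i)))
    ⟨b, Finset.mem_univ _, mul_pos h.pos_right (sub_pos.2 h.lt)⟩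

theorem mean_lt (h : IsSpread lam a b p) : mean lam p < lam b := by
  rw [← sub_pos, sub_mean h.sum_eq]
  exact Finset.sum_pos' (fun i _ => mul_nonneg (h.nonneg i) (sub_nonneg.2 (h.lam_le i)))
    ⟨a, Finset.mem_univ _, mul_pos h.pos_left (sub_pos.2 h.lt)⟩

theorem spread_pos (h : IsSpread lam a b p) : 0 < spread lam p :=
  Finset.sum_pos' (fun i _ => mul_nonneg (h.nonneg i) (sq_nonneg _))
    ⟨a, Finset.mem_univ _, mul_pos h.pos_left (sq_pos_of_neg (sub_neg.2 h.lt_mean))⟩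

theorem defect_nonneg (h : IsSpread lam a b p) (i : ι) :
    0 ≤ p i * ((lam i - lam a) * (lam b - lam i)) :=
  mul_nonneg (h.nonneg i) (mul_nonneg (sub_nonneg.2 (h.le_lam i)) (sub_nonneg.2 (h.lam_le i)))

theorem spread_le (h : IsSpread lam a b p) :
    spread lam p ≤ (mean lam p - lam a) * (lam b - mean lam p) := by
  rw [← sub_nonneg, bhatia_davis h.sum_eq]
  exact Finset.sum_nonneg fun i _ => h.defect_nonneg i

theorem spread_le_sq (h : IsSpread lam a b p) : spread lam p ≤ (lam b - lam a) ^ 2 := by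
  have := h.lt_mean
  have := h.mean_lt
  nlinarith [h.spread_le]

theorem le_one (h : IsSpread lam a b p) (i : ι) : p i ≤ 1 :=
  h.sum_eq ▸ Finset.single_le_sum (fun j _ => h.nonneg j) (Finset.mem_univ i)

/-- Reweighting by the squared deviation from the mean. -/
theorem succ (h : IsSpread lam a b p) {q : ι → ℝ}
    (hq : ∀ i, q i = p i * (lam i - mean lam p) ^ 2 / spread lam p) : IsSpread lam a b q where
  lt := h.lt
  bounds := h.bounds
  nonneg i := by
    rw [hq]
    exact div_nonneg (mul_nonneg (h.nonneg i) (sq_nonneg _)) h.spread_pos.le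
  sum_eq := by
    simp only [hq, ← Finset.sum_div]
    exact div_self h.spread_pos.ne'
  pos_left := by
    rw [hq]
    exact div_pos (mul_pos h.pos_left (sq_pos_of_neg (sub_neg.2 h.lt_mean))) h.spread_pos
  pos_right := by
    rw [hq]
    exact div_pos (mul_pos h.pos_right (sq_pos_of_pos (sub_pos.2 h.mean_lt))) h.spread_pos

end IsSpread

variable {lam : ι → ℝ} {a b : ι} {p : ℕ → ι → ℝ}

theorem IsSpread.iterate (h0 : IsSpread lam a b (p 0))
    (hstep : ∀ n i, p (n + 1) i = p n i * (lam i - mean lam (p n)) ^ 2 / spread lam (p n)) (n : ℕ) :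
    IsSpread lam a b (p n) := by
  induction n with
  | zero => exact h0
  | succ n ih => exact ih.succ (hstep n)

/-- Each step multiplies `p a * p b` by `R²`, where `R` is the Bhatia–Davis ratio, at least 1. The
bounded monotone product has a positive limit, so `R → 1`. -/
theorem exists_tendsto_prod (h0 : IsSpread lam a b (p 0))
    (hstep : ∀ n i, p (n + 1) i = p n i * (lam i - mean lam (p n)) ^ 2 / spread lam (p n)) :
    (∃ L, 0 < L ∧ Tendsto (fun n => p n a * p n b) atTop (𝓝 L)) ∧
      ∀ i, i ≠ a → i ≠ b → Tendsto (fun n => p n i) atTop (𝓝 0) := by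
  have h := h0.iterate hstep
  set R : ℕ → ℝ := fun n =>
    (mean lam (p n) - lam a) * (lam b - mean lam (p n)) / spread lam (p n) with hR
  have hR1 : ∀ n, 1 ≤ R n := fun n => (one_le_div (h n).spread_pos).2 (h n).spread_le
  have hP : ∀ n, 0 < p n a * p n b := fun n => mul_pos (h n).pos_left (h n).pos_right
  have hsucc : ∀ n, p (n + 1) a * p (n + 1) b = p n a * p n b * R n ^ 2 := by
    intro n
    rw [hstep, hstep, hR]
    have := (h n).spread_pos.ne'
    field_simp
    ring
  have hmono : Monotone fun n => p n a * p n b := monotone_nat_of_le_succ fun n => by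
    rw [hsucc]
    exact le_mul_of_one_le_right (hP n).le (one_le_pow₀ (hR1 n))
  have hbdd : BddAbove (Set.range fun n => p n a * p n b) := by
    refine ⟨1, ?_⟩
    rintro _ ⟨n, rfl⟩
    exact mul_le_one₀ ((h n).le_one a) ((h n).nonneg b) ((h n).le_one b)
  have hlim := tendsto_atTop_ciSup hmono hbdd
  set L := ⨆ n, p n a * p n b
  have hL : 0 < L := (hP 0).trans_le (le_ciSup hbdd 0)
  refine ⟨⟨L, hL, hlim⟩, fun i hia hib => ?_⟩
  have hR2 : Tendsto (fun n => R n ^ 2) atTop (𝓝 1) := by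
    have := ((tendsto_add_atTop_iff_nat 1).2 hlim).div hlim hL.ne'
    rw [div_self hL.ne'] at this
    refine this.congr fun n => ?_
    simp only [Pi.div_apply, hsucc]
    exact mul_div_cancel_left₀ _ (hP n).ne'
  obtain ⟨hi1, hi2⟩ := h0.bounds i hia hib
  have hw : 0 < (lam i - lam a) * (lam b - lam i) := mul_pos (sub_pos.2 hi1) (sub_pos.2 hi2)
  set w := (lam i - lam a) * (lam b - lam i)
  -- The total defect is `(R - 1) * spread`, and it dominates its single term `p i * w`; then `R - 1
  -- ≤ R² - 1`.
  have hub : ∀ n, p n i ≤ (R n ^ 2 - 1) * ((lam b - lam a) ^ 2 / w) := by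
    intro n
    have h1 : p n i * w ≤ (R n - 1) * spread lam (p n) := by
      rw [sub_mul, hR, div_mul_cancel₀ _ (h n).spread_pos.ne', one_mul, bhatia_davis (h n).sum_eq]
      exact Finset.single_le_sum (fun j _ => (h n).defect_nonneg j) (Finset.mem_univ i)
    have h2 : (R n - 1) * spread lam (p n) ≤ (R n ^ 2 - 1) * (lam b - lam a) ^ 2 :=
      mul_le_mul (by nlinarith [hR1 n]) (h n).spread_le_sq (h n).spread_pos.le
        (by nlinarith [hR1 n])
    rw [← mul_div_assoc, le_div_iff₀ hw]
    exact h1.trans h2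
  refine squeeze_zero (fun n => (h n).nonneg i) hub ?_
  simpa using (hR2.sub_const 1).mul_const ((lam b - lam a) ^ 2 / w)

theorem tendsto_sum_interior {f : ℕ → ι → ℝ} (a b : ι) [DecidableEq ι]
    (hab : a ≠ b) (hf : ∀ i, i ≠ a → i ≠ b → Tendsto (fun n => f n i) atTop (𝓝 0)) :
    Tendsto (fun n => ∑ i, f n i - f n a - f n b) atTop (𝓝 0) := by
  have hsum : ∀ n, ∑ i, f n i - f n a - f n b
      = ∑ i ∈ (Finset.univ.erase a).erase b, f n i := by
    intro n
    rw [← Finset.add_sum_erase _ _ (Finset.mem_univ a),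
      ← Finset.add_sum_erase _ _ (Finset.mem_erase.2 ⟨hab.symm, Finset.mem_univ b⟩)]
    ring
  simp only [hsum]
  rw [← Finset.sum_const_zero (s := (Finset.univ.erase a).erase b)]
  refine tendsto_finsetSum _ fun i hi => ?_
  simp only [Finset.mem_erase, Finset.mem_univ, and_true] at hi
  exact hf i hi.2 hi.1

/-- Akaike's theorem: the even iterates of the reweighting converge to a two-point vector carried by
the extreme points, and the odd ones to its mirror image. -/
theorem exists_tendsto_twoPoint [DecidableEq ι] (h0 : IsSpread lam a b (p 0))
    (hstep : ∀ n i, p (n + 1) i = p n i * (lam i - mean lam (p n)) ^ 2 / spread lam (p n)) :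
    ∃ r, 0 < r ∧ r < 1 ∧ Tendsto (fun n => p (2 * n)) atTop (𝓝 (twoPoint a b r)) ∧
      Tendsto (fun n => p (2 * n + 1)) atTop (𝓝 (twoPoint a b (1 - r))) := by
  have h := h0.iterate hstep
  have hab := h0.ne
  obtain ⟨⟨L, hL, hprod⟩, hint⟩ := exists_tendsto_prod h0 hstep
  have hd : 0 < lam b - lam a := sub_pos.2 h0.lt
  set d := lam b - lam a
  have hone : Tendsto (fun n => 1 - p n a - p n b) atTop (𝓝 0) :=
    (tendsto_sum_interior a b hab hint).congr fun n => by rw [(h n).sum_eq]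
  have hmean : Tendsto (fun n => mean lam (p n) - lam a - p n b * d) atTop (𝓝 0) := by
    refine (tendsto_sum_interior (f := fun n i => p n i * (lam i - lam a)) a b hab
      fun i h1 h2 => by simpa using (hint i h1 h2).mul_const (lam i - lam a)).congr fun n => ?_
    rw [← mean_sub (h n).sum_eq]
    ring
  have hdefect : Tendsto (fun n => (mean lam (p n) - lam a) * (lam b - mean lam (p n))
      - spread lam (p n)) atTop (𝓝 0) := by
    refine (tendsto_sum_interior (f := fun n i => p n i * ((lam i - lam a) * (lam b - lam i)))
      a b hab fun i h1 h2 => by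
        simpa using (hint i h1 h2).mul_const ((lam i - lam a) * (lam b - lam i))).congr
      fun n => ?_
    rw [← bhatia_davis (h n).sum_eq]
    ring
  -- `e`, `X` and `D` measure the deviation from a two-point vector: in total mass, in mean, and in
  -- the Bhatia–Davis equality. The bound `hsum` on them serves for both estimates below.
  set e : ℕ → ℝ := fun n => 1 - p n a - p n b with he
  set X : ℕ → ℝ := fun n => mean lam (p n) - lam a - p n b * d with hX
  set D : ℕ → ℝ := fun n => (mean lam (p n) - lam a) * (lam b - mean lam (p n))
    - spread lam (p n) with hD
  have hM0 : ∀ n, 0 ≤ mean lam (p n) - lam a := fun n => (sub_pos.2 (h n).lt_mean).le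
  have hMd : ∀ n, mean lam (p n) - lam a ≤ d := fun n => sub_le_sub_right (h n).mean_lt.le _
  have hsum : Tendsto (fun n => d ^ 2 * |e n| + 2 * d * |X n| + |D n|) atTop (𝓝 0) := by
    simpa using ((hone.abs.const_mul (d ^ 2)).add (hmean.abs.const_mul (2 * d))).add hdefect.abs
  have hspread : Tendsto (fun n => spread lam (p n)) atTop (𝓝 (L * d ^ 2)) := by
    have h1 : Tendsto (fun n => spread lam (p n) - p n a * p n b * d ^ 2) atTop (𝓝 0) := by
      refine squeeze_zero_norm (fun n => ?_) hsum
      have h2 : spread lam (p n) - p n a * p n b * d ^ 2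
          = (p n b * d ^ 2) * e n + ((d - (mean lam (p n) - lam a)) - p n b * d) * X n - D n := by
        simp only [he, hX, hD, d]
        ring
      have h3 : |p n b * d ^ 2| ≤ d ^ 2 := by
        rw [abs_of_nonneg (mul_nonneg ((h n).nonneg b) (sq_nonneg d))]
        exact mul_le_of_le_one_left (sq_nonneg d) ((h n).le_one b)
      have h4 : |(d - (mean lam (p n) - lam a)) - p n b * d| ≤ 2 * d := by
        have := mul_le_of_le_one_left hd.le ((h n).le_one b)
        have := mul_nonneg ((h n).nonneg b) hd.le
        have := hM0 n
        have := hMd n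
        rw [abs_le]
        constructor <;> linarith
      rw [h2, Real.norm_eq_abs]
      refine (abs_sub _ _).trans (add_le_add_left ((abs_add_le _ _).trans ?_) _)
      rw [abs_mul (p n b * d ^ 2), abs_mul (d - _ - _)]
      gcongr
    have h2 := h1.add (hprod.mul_const (d ^ 2))
    rw [zero_add] at h2
    exact h2.congr fun n => sub_add_cancel _ _
  -- For an exact two-point vector, `m - λ_a = p_b d` and the variance is `p_a p_b d²`, so the new
  -- mass at `a` is `p_b`.
  have hswap : Tendsto (fun n => p (n + 1) a - p n b) atTop (𝓝 0) := by
    have h1 : Tendsto (fun n => p n a * (lam a - mean lam (p n)) ^ 2 - p n b * spread lam (p n))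
        atTop (𝓝 0) := by
      refine squeeze_zero_norm (fun n => ?_) hsum
      have h2 : p n a * (lam a - mean lam (p n)) ^ 2 - p n b * spread lam (p n)
          = (mean lam (p n) - lam a) * X n - (mean lam (p n) - lam a) ^ 2 * e n
            + p n b * D n := by
        simp only [he, hX, hD, d]
        ring
      have h3 : |mean lam (p n) - lam a| ≤ d := by
        rw [abs_of_nonneg (hM0 n)]
        exact hMd n
      have h4 : |p n b| ≤ 1 := by
        rw [abs_of_nonneg ((h n).nonneg b)]
        exact (h n).le_one b
      rw [h2, Real.norm_eq_abs]
      calc _ ≤ |mean lam (p n) - lam a| * |X n| + |mean lam (p n) - lam a| ^ 2 * |e n|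
            + |p n b| * |D n| := by
            rw [← abs_mul, ← abs_pow, ← abs_mul, ← abs_mul]
            exact (abs_add_le _ _).trans (add_le_add_left (abs_sub _ _) _)
        _ ≤ d * |X n| + d ^ 2 * |e n| + 1 * |D n| := by gcongr
        _ ≤ _ := by nlinarith [mul_nonneg hd.le (abs_nonneg (X n))]
    have h2 := h1.div hspread (mul_pos hL (pow_pos hd 2)).ne'
    rw [zero_div] at h2
    refine h2.congr fun n => ?_
    rw [Pi.div_apply, hstep, sub_div, mul_div_cancel_right₀ _ (h n).spread_pos.ne']
  have hpair : Tendsto (fun n => p (n + 1) a + p n a) atTop (𝓝 1) := by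
    have h1 := (hswap.sub hone).add_const 1
    rw [sub_zero, zero_add] at h1
    exact h1.congr fun n => by simp only [he]; ring
  have heven : Tendsto (fun n : ℕ => 2 * n) atTop atTop :=
    tendsto_atTop_mono (fun n => Nat.le_mul_of_pos_left n two_pos) tendsto_id
  have hodd : Tendsto (fun n : ℕ => 2 * n + 1) atTop atTop := (tendsto_add_atTop_nat 1).comp heven
  have hprod' : Tendsto (fun n => p n a * (1 - p n a)) atTop (𝓝 L) := by
    have h1 : Tendsto (fun n => p n a * e n) atTop (𝓝 0) := by
      refine squeeze_zero_norm (fun n => ?_) (by simpa using hone.abs)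
      rw [Real.norm_eq_abs, abs_mul, abs_of_nonneg ((h n).nonneg a)]
      exact mul_le_of_le_one_left (abs_nonneg _) ((h n).le_one a)
    have h2 := hprod.add h1
    rw [add_zero] at h2
    exact h2.congr fun n => by simp only [he]; ring
  -- Subtracting `hpair` at `2n` from `hpair` at `2n + 1` leaves the increment of the even
  -- subsequence.
  obtain ⟨r, hr⟩ := tendsto_of_mul_one_sub (x := fun n => p (2 * n) a) (hprod'.comp heven) (by
    have h1 := (hpair.comp hodd).sub (hpair.comp heven)
    rw [sub_self] at h1
    exact h1.congr fun n => by
      simp only [Function.comp_apply, mul_add, mul_one, add_assoc, Nat.reduceAdd]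
      ring)
  have hrL : r * (1 - r) = L :=
    tendsto_nhds_unique (hr.mul (hr.const_sub 1)) (hprod'.comp heven)
  have hodd_a : Tendsto (fun n => p (2 * n + 1) a) atTop (𝓝 (1 - r)) :=
    ((hpair.comp heven).sub hr).congr fun n => by simp
  have hlim : ∀ {s : ℝ} {k : ℕ → ℕ}, Tendsto k atTop atTop →
      Tendsto (fun n => p (k n) a) atTop (𝓝 s) →
      Tendsto (fun n => p (k n)) atTop (𝓝 (twoPoint a b s)) := by
    intro s k hk hs
    rw [tendsto_pi_nhds]
    intro i
    unfold twoPoint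
    split_ifs with h1 h2
    · rwa [h1]
    · rw [h2]
      have h3 := (hs.const_sub 1).sub (hone.comp hk)
      rw [sub_zero] at h3
      exact h3.congr fun n => by simp only [he, Function.comp_apply]; ring
    · exact (hint i h1 h2).comp hk
  refine ⟨r, ?_, ?_, hlim heven hr, hlim hodd hodd_a⟩ <;> nlinarith

end Weights

end MinimalGradient

namespace MinimalGradient

/-! ### From the gradient iteration to the weight dynamics -/

section Spectral

variable {N : ℕ} {A : Matrix (Fin N) (Fin N) ℝ} {lam : Fin N → ℝ}
  {v : OrthonormalBasis (Fin N) ℝ (EuclideanSpace ℝ (Fin N))}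

theorem repr_toEuclideanLin (hv : ∀ i, Matrix.toEuclideanLin A (v i) = lam i • v i)
    (g : EuclideanSpace ℝ (Fin N)) (i : Fin N) :
    v.repr (Matrix.toEuclideanLin A g) i = lam i * v.repr g i := by
  have h : Matrix.toEuclideanLin A g = ∑ j, (lam j * v.repr g j) • v j := by
    conv_lhs => rw [← v.sum_repr g]
    simp only [map_sum, map_smul, hv, smul_smul]
    exact Finset.sum_congr rfl fun j _ => by rw [mul_comm]
  rw [h, v.repr_apply_apply, v.orthonormal.inner_right_fintype]

theorem quad_eq_sum (hv : ∀ i, Matrix.toEuclideanLin A (v i) = lam i • v i)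
    (g : EuclideanSpace ℝ (Fin N)) : quad A g = ∑ i, lam i * v.repr g i ^ 2 := by
  rw [quad, ← v.repr.inner_map_map, PiLp.inner_apply]
  refine Finset.sum_congr rfl fun i _ => ?_
  rw [repr_toEuclideanLin hv]
  simp only [RCLike.inner_apply, conj_trivial]
  ring

theorem toEuclideanLin_sq (hv : ∀ i, Matrix.toEuclideanLin A (v i) = lam i • v i) (i : Fin N) :
    Matrix.toEuclideanLin (A ^ 2) (v i) = lam i ^ 2 • v i := by
  rw [pow_two, Matrix.toEuclideanLin, Matrix.toLpLin_mul_same, LinearMap.comp_apply, hv, map_smul,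
    hv, smul_smul, pow_two]

theorem eigenvalue_pos (hA : A.PosDef)
    (hv : ∀ i, Matrix.toEuclideanLin A (v i) = lam i • v i) (i : Fin N) : 0 < lam i := by
  have h1 : v i ≠ 0 := v.orthonormal.ne_zero i
  have h2 : 0 < inner ℝ (v i) (Matrix.toEuclideanLin A (v i)) := by
    rw [EuclideanSpace.inner_eq_star_dotProduct, dotProduct_comm]
    exact hA.dotProduct_mulVec_pos (by simpa using h1)
  rw [hv, inner_smul_right, real_inner_self_eq_norm_sq, v.orthonormal.1] at h2
  simpa using h2

theorem norm_sq_eq_sum (v : OrthonormalBasis (Fin N) ℝ (EuclideanSpace ℝ (Fin N)))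
    (g : EuclideanSpace ℝ (Fin N)) : ‖g‖ ^ 2 = ∑ i, v.repr g i ^ 2 := by
  rw [← v.repr.norm_map, EuclideanSpace.real_norm_sq_eq]

variable {b x₀ : EuclideanSpace ℝ (Fin N)}

theorem gradSeq_succ (n : ℕ) : gradSeq A b x₀ (n + 1)
    = gradSeq A b x₀ n - stepSeq A b x₀ n • Matrix.toEuclideanLin A (gradSeq A b x₀ n) := by
  simp only [gradSeq, stepSeq, iter, grad, map_sub, map_smul]
  abel

theorem coeff_succ (hv : ∀ i, Matrix.toEuclideanLin A (v i) = lam i • v i) (i : Fin N) (n : ℕ) :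
    coeff A b x₀ v i (n + 1) = (1 - stepSeq A b x₀ n * lam i) * coeff A b x₀ v i n := by
  simp only [coeff, gradSeq_succ, map_sub, map_smul, PiLp.sub_apply, PiLp.smul_apply,
    repr_toEuclideanLin hv, smul_eq_mul]
  ring

theorem quad_gradSeq (hv : ∀ i, Matrix.toEuclideanLin A (v i) = lam i • v i) (n : ℕ) :
    quad A (gradSeq A b x₀ n) = ∑ j, lam j * coeff A b x₀ v j n ^ 2 :=
  quad_eq_sum hv _

theorem weight_eq (hv : ∀ i, Matrix.toEuclideanLin A (v i) = lam i • v i) (i : Fin N) (n : ℕ) :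
    weight A b x₀ v lam i n
      = lam i * coeff A b x₀ v i n ^ 2 / quad A (gradSeq A b x₀ n) := by
  rw [weight, quad_gradSeq hv]

theorem stepSeq_eq (hv : ∀ i, Matrix.toEuclideanLin A (v i) = lam i • v i) (n : ℕ) :
    stepSeq A b x₀ n = (mean lam fun i => weight A b x₀ v lam i n)⁻¹ := by
  rw [stepSeq, step, quad_eq_sum (toEuclideanLin_sq hv), mean, ← inv_div]
  congr 1
  simp only [weight_eq hv, div_mul_eq_mul_div, ← Finset.sum_div]
  congr 1
  exact Finset.sum_congr rfl fun i _ => by rw [coeff]; ring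

theorem quad_pos (hlam : ∀ i, 0 < lam i)
    (hv : ∀ i, Matrix.toEuclideanLin A (v i) = lam i • v i) {i : Fin N} {n : ℕ}
    (hi : coeff A b x₀ v i n ≠ 0) : 0 < quad A (gradSeq A b x₀ n) := by
  rw [quad_gradSeq hv]
  exact Finset.sum_pos' (fun j _ => mul_nonneg (hlam j).le (sq_nonneg _))
    ⟨i, Finset.mem_univ _, mul_pos (hlam i) (by positivity)⟩

theorem isSpread_weight (hlam : ∀ i, 0 < lam i) (hmono : StrictMono lam)
    (hv : ∀ i, Matrix.toEuclideanLin A (v i) = lam i • v i) {s t : Fin N} (hst : s < t)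
    (hs : ∀ i, s ≤ i) (ht : ∀ i, i ≤ t) {n : ℕ}
    (hs0 : coeff A b x₀ v s n ≠ 0) (ht0 : coeff A b x₀ v t n ≠ 0) :
    IsSpread lam s t fun i => weight A b x₀ v lam i n where
  lt := hmono hst
  bounds i h1 h2 := ⟨hmono ((hs i).lt_of_ne' h1), hmono ((ht i).lt_of_ne h2)⟩
  nonneg i := by
    rw [weight_eq hv]
    exact div_nonneg (mul_nonneg (hlam i).le (sq_nonneg _)) (quad_pos hlam hv hs0).le
  sum_eq := by
    simp only [weight_eq hv, ← Finset.sum_div]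
    rw [← quad_gradSeq hv]
    exact div_self (quad_pos hlam hv hs0).ne'
  pos_left := by
    rw [weight_eq hv]
    exact div_pos (mul_pos (hlam s) (by positivity)) (quad_pos hlam hv hs0)
  pos_right := by
    rw [weight_eq hv]
    exact div_pos (mul_pos (hlam t) (by positivity)) (quad_pos hlam hv hs0)

theorem coeff_succ_ne_zero
    (hv : ∀ i, Matrix.toEuclideanLin A (v i) = lam i • v i) {n : ℕ} {i : Fin N}
    (hm : mean lam (fun i => weight A b x₀ v lam i n) ≠ 0)
    (hi : mean lam (fun i => weight A b x₀ v lam i n) ≠ lam i)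
    (h0 : coeff A b x₀ v i n ≠ 0) : coeff A b x₀ v i (n + 1) ≠ 0 := by
  rw [coeff_succ hv, stepSeq_eq hv]
  refine mul_ne_zero (fun h => hi ?_) h0
  field_simp at h
  linarith

/-- Since `ζ_i` is scaled by `(m - λ_i) / m`, summing `λ_i ζ_i²` produces the variance over `m²`. -/
theorem quad_succ (hlam : ∀ i, 0 < lam i)
    (hv : ∀ i, Matrix.toEuclideanLin A (v i) = lam i • v i) {n : ℕ} {i : Fin N}
    (hm : mean lam (fun i => weight A b x₀ v lam i n) ≠ 0)
    (h0 : coeff A b x₀ v i n ≠ 0) :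
    quad A (gradSeq A b x₀ (n + 1)) = quad A (gradSeq A b x₀ n)
      * (spread lam (fun i => weight A b x₀ v lam i n)
        / mean lam (fun i => weight A b x₀ v lam i n) ^ 2) := by
  have hq := (quad_pos hlam hv h0).ne'
  rw [quad_gradSeq hv, spread, Finset.sum_div, Finset.mul_sum]
  refine Finset.sum_congr rfl fun j _ => ?_
  rw [coeff_succ hv, stepSeq_eq hv, weight_eq hv]
  field_simp
  ring

theorem weight_succ (hlam : ∀ i, 0 < lam i)
    (hv : ∀ i, Matrix.toEuclideanLin A (v i) = lam i • v i) {n : ℕ} {i : Fin N}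
    (hm : mean lam (fun i => weight A b x₀ v lam i n) ≠ 0)
    (hs : spread lam (fun i => weight A b x₀ v lam i n) ≠ 0)
    (h0 : coeff A b x₀ v i n ≠ 0) (j : Fin N) :
    weight A b x₀ v lam j (n + 1) = weight A b x₀ v lam j n
      * (lam j - mean lam (fun i => weight A b x₀ v lam i n)) ^ 2
      / spread lam (fun i => weight A b x₀ v lam i n) := by
  have hq := (quad_pos hlam hv h0).ne'
  rw [weight_eq hv j (n + 1), quad_succ hlam hv hm h0, coeff_succ hv, stepSeq_eq hv,
    weight_eq hv j n]
  field_simp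
  ring

theorem norm_sq_gradSeq (hlam : ∀ i, 0 < lam i)
    (hv : ∀ i, Matrix.toEuclideanLin A (v i) = lam i • v i) {n : ℕ}
    (hq : quad A (gradSeq A b x₀ n) ≠ 0) :
    ‖gradSeq A b x₀ n‖ ^ 2 = quad A (gradSeq A b x₀ n)
      * ∑ i, weight A b x₀ v lam i n * (lam i)⁻¹ := by
  rw [norm_sq_eq_sum v, Finset.mul_sum]
  refine Finset.sum_congr rfl fun i _ => ?_
  have := (hlam i).ne'
  rw [weight_eq hv, coeff]
  field_simp

end Spectral

theorem tendsto_of_even_odd {α : Type*} {f : ℕ → α} {l : Filter α}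
    (h0 : Tendsto (fun n => f (2 * n)) atTop l) (h1 : Tendsto (fun n => f (2 * n + 1)) atTop l) :
    Tendsto f atTop l := by
  intro s hs
  obtain ⟨n₀, hn₀⟩ := mem_atTop_sets.1 (inter_mem (h0 hs) (h1 hs))
  refine mem_atTop_sets.2 ⟨2 * n₀, fun n hn => ?_⟩
  obtain ⟨k, rfl | rfl⟩ := n.even_or_odd'
  · exact (hn₀ k (by lia)).1
  · exact (hn₀ k (by lia)).2

end MinimalGradient

namespace MinimalGradient

/-! ### Limits of steplengths and gradient ratios -/

section Limits

variable {N : ℕ} {A : Matrix (Fin N) (Fin N) ℝ} {lam : Fin N → ℝ}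
  {v : OrthonormalBasis (Fin N) ℝ (EuclideanSpace ℝ (Fin N))} {b x₀ : EuclideanSpace ℝ (Fin N)}
  {s t : Fin N}

/-- The mean lies strictly between the extreme eigenvalues, so the factor `1 - λ_i / m` never
vanishes at either end. -/
theorem coeff_ne_zero (hpos : ∀ i, 0 < lam i) (hlam : StrictMono lam)
    (hv : ∀ i, Matrix.toEuclideanLin A (v i) = lam i • v i) (hst : s < t)
    (hs : ∀ i, s ≤ i) (ht : ∀ i, i ≤ t)
    (hs0 : coeff A b x₀ v s 0 ≠ 0) (ht0 : coeff A b x₀ v t 0 ≠ 0) (n : ℕ) :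
    coeff A b x₀ v s n ≠ 0 ∧ coeff A b x₀ v t n ≠ 0 := by
  induction n with
  | zero => exact ⟨hs0, ht0⟩
  | succ n ih =>
    have h := isSpread_weight hpos hlam hv hst hs ht ih.1 ih.2
    have hm := ((hpos s).trans h.lt_mean).ne'
    exact ⟨coeff_succ_ne_zero hv hm h.lt_mean.ne' ih.1,
      coeff_succ_ne_zero hv hm h.mean_lt.ne ih.2⟩

variable {r : ℝ} {k : ℕ → ℕ}

theorem tendsto_mean (hst : s ≠ t) {p : ℕ → Fin N → ℝ}
    (h : Tendsto p atTop (𝓝 (twoPoint s t r))) :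
    Tendsto (fun n => mean lam (p n)) atTop (𝓝 (r * lam s + (1 - r) * lam t)) := by
  rw [← mean_twoPoint hst]
  exact ((continuous_mean lam).tendsto _).comp h

theorem tendsto_stepSeq (hv : ∀ i, Matrix.toEuclideanLin A (v i) = lam i • v i) (hst : s ≠ t)
    (hr : r * lam s + (1 - r) * lam t ≠ 0)
    (h : Tendsto (fun n i => weight A b x₀ v lam i (k n)) atTop (𝓝 (twoPoint s t r))) :
    Tendsto (fun n => stepSeq A b x₀ (k n)) atTop (𝓝 (r * lam s + (1 - r) * lam t)⁻¹) :=
  ((tendsto_mean hst h).inv₀ hr).congr fun _ => (stepSeq_eq hv _).symm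

theorem tendsto_quad_ratio (hpos : ∀ i, 0 < lam i)
    (hv : ∀ i, Matrix.toEuclideanLin A (v i) = lam i • v i) (hst : s ≠ t)
    (hsp : ∀ n, IsSpread lam s t fun i => weight A b x₀ v lam i n)
    (h0 : ∀ n, coeff A b x₀ v s n ≠ 0)
    (hr : r * lam s + (1 - r) * lam t ≠ 0)
    (h : Tendsto (fun n i => weight A b x₀ v lam i (k n)) atTop (𝓝 (twoPoint s t r))) :
    Tendsto (fun n => quad A (gradSeq A b x₀ (k n + 1)) / quad A (gradSeq A b x₀ (k n))) atTop
      (𝓝 (r * (1 - r) * (lam t - lam s) ^ 2 / (r * lam s + (1 - r) * lam t) ^ 2)) := by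
  rw [← spread_twoPoint hst]
  refine ((((continuous_spread lam).tendsto _).comp h).div ((tendsto_mean hst h).pow 2)
    (pow_ne_zero 2 hr)).congr fun n => ?_
  rw [quad_succ hpos hv ((hpos s).trans (hsp _).lt_mean).ne' (h0 _),
    mul_div_cancel_left₀ _ (quad_pos hpos hv (h0 _)).ne']
  rfl

theorem tendsto_sum_inv (hst : s ≠ t) {p : ℕ → Fin N → ℝ}
    (h : Tendsto p atTop (𝓝 (twoPoint s t r))) :
    Tendsto (fun n => ∑ i, p n i * (lam i)⁻¹) atTop
      (𝓝 (r * (lam s)⁻¹ + (1 - r) * (lam t)⁻¹)) := by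
  rw [← sum_twoPoint hst r fun i => (lam i)⁻¹]
  exact tendsto_finsetSum _ fun i _ => (tendsto_pi_nhds.1 h i).mul_const _

/-- `‖g‖²` is `gᵀAg` times the weighted mean of `1 / λ`. The limit is symmetric under `r ↔ 1 - r`,
which is why the norm ratio converges along the whole sequence. -/
theorem tendsto_norm_ratio (hpos : ∀ i, 0 < lam i)
    (hv : ∀ i, Matrix.toEuclideanLin A (v i) = lam i • v i) (hst : s ≠ t)
    (hsp : ∀ n, IsSpread lam s t fun i => weight A b x₀ v lam i n)
    (h0 : ∀ n, coeff A b x₀ v s n ≠ 0) (hr0 : 0 < r) (hr1 : 0 < 1 - r)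
    (h : Tendsto (fun n i => weight A b x₀ v lam i (k n)) atTop (𝓝 (twoPoint s t r)))
    (h' : Tendsto (fun n i => weight A b x₀ v lam i (k n + 1)) atTop
      (𝓝 (twoPoint s t (1 - r)))) :
    Tendsto (fun n => ‖gradSeq A b x₀ (k n + 1)‖ ^ 2 / ‖gradSeq A b x₀ (k n)‖ ^ 2) atTop
      (𝓝 (r * (1 - r) * (lam t - lam s) ^ 2
        / ((r * lam s + (1 - r) * lam t) * ((1 - r) * lam s + r * lam t)))) := by
  have hs := hpos s
  have ht := hpos t
  have hm0 : 0 < r * lam s + (1 - r) * lam t := by positivity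
  have hm1 : 0 < (1 - r) * lam s + r * lam t := by positivity
  have hi0 : r * (lam s)⁻¹ + (1 - r) * (lam t)⁻¹
      = ((1 - r) * lam s + r * lam t) / (lam s * lam t) := by field_simp; ring
  have hi1 : (1 - r) * (lam s)⁻¹ + r * (lam t)⁻¹
      = (r * lam s + (1 - r) * lam t) / (lam s * lam t) := by field_simp; ring
  have hlim := (tendsto_quad_ratio hpos hv hst hsp h0 hm0.ne' h).mul
    ((tendsto_sum_inv (lam := lam) hst h').div (tendsto_sum_inv (lam := lam) hst h)
      (by rw [hi0]; positivity))
  have hval : r * (1 - r) * (lam t - lam s) ^ 2 / (r * lam s + (1 - r) * lam t) ^ 2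
      * (((1 - r) * (lam s)⁻¹ + (1 - (1 - r)) * (lam t)⁻¹)
        / (r * (lam s)⁻¹ + (1 - r) * (lam t)⁻¹))
      = r * (1 - r) * (lam t - lam s) ^ 2
        / ((r * lam s + (1 - r) * lam t) * ((1 - r) * lam s + r * lam t)) := by
    rw [sub_sub_cancel, hi0, hi1]
    field_simp
  rw [hval] at hlim
  refine hlim.congr fun n => ?_
  rw [norm_sq_gradSeq hpos hv (quad_pos hpos hv (h0 _)).ne',
    norm_sq_gradSeq hpos hv (quad_pos hpos hv (h0 _)).ne', mul_div_mul_comm]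
  rfl

end Limits

end MinimalGradient

theorem theorem1 (N : ℕ) (hN : 2 ≤ N)
    (A : Matrix (Fin N) (Fin N) ℝ) (hA : A.PosDef)
    (b x₀ : EuclideanSpace ℝ (Fin N))
    (lam : Fin N → ℝ) (hlam : StrictMono lam)
    (v : OrthonormalBasis (Fin N) ℝ (EuclideanSpace ℝ (Fin N)))
    (hv : ∀ i, Matrix.toEuclideanLin A (v i) = lam i • v i)
    (first last : Fin N) (hfirst : (first : ℕ) = 0) (hlast : (last : ℕ) = N - 1)
    (h_first : MinimalGradient.coeff A b x₀ v first 0 ≠ 0)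
    (h_last : MinimalGradient.coeff A b x₀ v last 0 ≠ 0)
    (κ : ℝ) (hκ : κ = lam last / lam first) :
    ∃ c : ℝ, c ≠ 0 ∧
      (∀ i, Tendsto (fun n => MinimalGradient.weight A b x₀ v lam i (2 * n)) atTop
        (𝓝 (if i = first then 1 / (1 + c ^ 2)
          else if i = last then c ^ 2 / (1 + c ^ 2) else 0))) ∧
      (∀ i, Tendsto (fun n => MinimalGradient.weight A b x₀ v lam i (2 * n + 1)) atTop
        (𝓝 (if i = first then c ^ 2 / (1 + c ^ 2)
          else if i = last then 1 / (1 + c ^ 2) else 0))) ∧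
      Tendsto (fun n => MinimalGradient.stepSeq A b x₀ (2 * n)) atTop
        (𝓝 ((1 + c ^ 2) / (lam first * (1 + c ^ 2 * κ)))) ∧
      Tendsto (fun n => MinimalGradient.stepSeq A b x₀ (2 * n + 1)) atTop
        (𝓝 ((1 + c ^ 2) / (lam first * (c ^ 2 + κ)))) ∧
      Tendsto (fun n => ‖MinimalGradient.gradSeq A b x₀ (n + 1)‖ ^ 2 /
          ‖MinimalGradient.gradSeq A b x₀ n‖ ^ 2) atTop
        (𝓝 (c ^ 2 * (κ - 1) ^ 2 / ((c ^ 2 + κ) * (1 + c ^ 2 * κ)))) ∧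
      Tendsto (fun n => MinimalGradient.quad A (MinimalGradient.gradSeq A b x₀ (2 * n + 1)) /
          MinimalGradient.quad A (MinimalGradient.gradSeq A b x₀ (2 * n))) atTop
        (𝓝 (c ^ 2 * (κ - 1) ^ 2 / (1 + c ^ 2 * κ) ^ 2)) ∧
      Tendsto (fun n => MinimalGradient.quad A (MinimalGradient.gradSeq A b x₀ (2 * n + 2)) /
          MinimalGradient.quad A (MinimalGradient.gradSeq A b x₀ (2 * n + 1))) atTop
        (𝓝 (c ^ 2 * (κ - 1) ^ 2 / (c ^ 2 + κ) ^ 2)) := by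
  have hpos := MinimalGradient.eigenvalue_pos hA hv
  have hst : first < last := Fin.lt_def.2 (by lia)
  have hs : ∀ i, first ≤ i := fun i => Fin.le_def.2 (by lia)
  have ht : ∀ i, i ≤ last := fun i => Fin.le_def.2 (by lia)
  have hne := MinimalGradient.coeff_ne_zero hpos hlam hv hst hs ht h_first h_last
  have hsp : ∀ n, MinimalGradient.IsSpread lam first last
      fun i => MinimalGradient.weight A b x₀ v lam i n :=
    fun n => MinimalGradient.isSpread_weight hpos hlam hv hst hs ht (hne n).1 (hne n).2
  obtain ⟨r, hr0, hr1, heven, hodd⟩ := MinimalGradient.exists_tendsto_twoPoint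
    (p := fun n i => MinimalGradient.weight A b x₀ v lam i n) (hsp 0) fun n i =>
      MinimalGradient.weight_succ hpos hv ((hpos first).trans (hsp n).lt_mean).ne'
        (hsp n).spread_pos.ne' (hne n).1 i
  have hla := hpos first
  have hlb := hpos last
  have hr : 0 < 1 - r := sub_pos.2 hr1
  have heven2 : Tendsto (fun n i => MinimalGradient.weight A b x₀ v lam i (2 * n + 1 + 1)) atTop
      (𝓝 (MinimalGradient.twoPoint first last (1 - (1 - r)))) := by
    rw [sub_sub_cancel]
    refine (heven.comp (tendsto_add_atTop_nat 1)).congr fun n => ?_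
    rw [Function.comp_apply, mul_add, mul_one, add_assoc]
  have hm0 : 0 < r * lam first + (1 - r) * lam last := by positivity
  have hm1 : 0 < (1 - r) * lam first + r * lam last := by positivity
  have hm1' : (1 - r) * lam first + (1 - (1 - r)) * lam last ≠ 0 := by
    rw [sub_sub_cancel]; exact hm1.ne'
  -- The witness `c = √((1 - r) / r)` is forced up to sign by `1 / (1 + c²) = r`.
  have hc2 : √((1 - r) / r) ^ 2 = (1 - r) / r := Real.sq_sqrt (by positivity)
  have hk0 : 1 + (1 - r) / r * (lam last / lam first)
      = (r * lam first + (1 - r) * lam last) / (r * lam first) := by field_simp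
  have hk1 : (1 - r) / r + lam last / lam first
      = ((1 - r) * lam first + r * lam last) / (r * lam first) := by field_simp
  have hc1 : 1 + (1 - r) / r = 1 / r := by field_simp; ring
  have hq0 := MinimalGradient.tendsto_quad_ratio hpos hv hst.ne hsp (fun n => (hne n).1)
    hm0.ne' heven
  have hq1 := MinimalGradient.tendsto_quad_ratio hpos hv hst.ne hsp (fun n => (hne n).1)
    hm1' hodd
  have hn0 := MinimalGradient.tendsto_norm_ratio hpos hv hst.ne hsp (fun n => (hne n).1)
    hr0 hr heven hodd
  have hn1 := MinimalGradient.tendsto_norm_ratio hpos hv hst.ne hsp (fun n => (hne n).1)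
    hr (hr0.trans_eq (sub_sub_cancel 1 r).symm) hodd heven2
  have ha0 := MinimalGradient.tendsto_stepSeq hv hst.ne hm0.ne' heven
  have ha1 := MinimalGradient.tendsto_stepSeq hv hst.ne hm1' hodd
  simp only [sub_sub_cancel] at hq1 hn1 ha1
  refine ⟨√((1 - r) / r), (Real.sqrt_pos.2 (by positivity)).ne', ?_⟩
  rw [hc2, hκ, hk0, hk1, hc1]
  have hw0 : 1 / (1 / r) = r := one_div_one_div r
  have hw1 : (1 - r) / r / (1 / r) = 1 - r := by field_simp
  rw [hw0, hw1]
  refine ⟨?_, ?_, ?_, ?_,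
    MinimalGradient.tendsto_of_even_odd ?_ ?_, ?_, ?_⟩
  · intro i
    have h := tendsto_pi_nhds.1 heven i
    rwa [MinimalGradient.twoPoint] at h
  · intro i
    have h := tendsto_pi_nhds.1 hodd i
    rwa [MinimalGradient.twoPoint, sub_sub_cancel] at h
  · convert ha0 using 2
    field_simp
  · convert ha1 using 2
    field_simp
  · convert hn0 using 2
    field_simp
  · convert hn1 using 2
    field_simp
  · convert hq0 using 2
    field_simp
  · convert hq1 using 2
    field_simp
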